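/- Let $G$ be a finite connected bipartite simple graph with $d$ vertices and $e$ edges, and let $c_4(G)$ denote the number of $4$-cycles of $G$, that is, the number of subgraphs of $G$ isomorphic to the cycle $C_4$ of length $4$. Then $$c_4(G) \le \binom{e-d+2}{2}.$$ If moreover $d \ge 2$ and $G$ has no vertices of degree one, then equality holds if and only if $G$ is isomorphic to the complete bipartite graph $K_{2,d-2}$. -/

import Mathlib

/-!
The bound is proved by deleting edges one at a time. Write `e` and `d` for the numbers of edges and
vertices, and fix the two sides `X`, `Y` of the bipartition. A 4-cycle is the same as a *rectangle*:
a pair of vertices of `X` and a pair of vertices of `Y` that are completely joined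
(`copyCount_cycleGraph_four_eq_card_rectangles`).

Let `uv` be an edge with `u ∈ X`, `v ∈ Y`. A 4-cycle through `uv` is determined by its edge `ab`
opposite to `uv`. If all these opposite edges are deleted, the graph stays connected, because `a`
and `b` are still joined by the path `a, v, u, b`. Hence there are at most `e + 1 - d` of them
(`Connected.card_oppositePairs_add_card_le`). If `uv` is not a bridge, deleting it leaves a connected
graph with one edge less, and `choose (n + 1) 2 = choose n 2 + n` gives the inductive step. A graph
in which all edges are bridges is a forest and has no 4-cycle.

If equality holds, then every edge `uv` that is not a bridge has exactly `e + 1 - d` opposite edges,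
so deleting these leaves a tree. Without vertices of degree one in the graph, every vertex must be
adjacent to `u` or to `v`: a vertex violating this, at maximal distance from `u` in the tree, has
two neighbours in the tree, both closer to `u`, which is impossible
(`Connected.adj_or_adj_of_card_oppositePairs_eq`). Applying this to all edges at an endpoint of one
non-bridge shows that the graph is complete bipartite. With sides of sizes `p, q ≥ 2`, equality
reads `choose p 2 * choose q 2 = choose ((p - 1) * (q - 1) + 1) 2`, that is,
`(p - 2) * (q - 2) = 0`.
-/

namespace SimpleGraph

variable {V : Type*} {G : SimpleGraph V} {X Y : Finset V} {u v : V}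

/-! ### Rectangles and 4-cycles -/

open Classical in
/-- The pairs `(P, Q)` of a two-element subset `P` of `X` and a two-element subset `Q` of `Y` such
that every vertex of `P` is adjacent to every vertex of `Q`. If `X` and `Y` are the sides of a
bipartition, these are the (unlabelled) 4-cycles of `G`. -/
noncomputable def rectangles (G : SimpleGraph V) (X Y : Finset V) : Finset (Finset V × Finset V) :=
  {r ∈ X.powersetCard 2 ×ˢ Y.powersetCard 2 | ∀ a ∈ r.1, ∀ b ∈ r.2, G.Adj a b}

lemma mem_rectangles {P Q : Finset V} :
    (P, Q) ∈ G.rectangles X Y ↔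
      ((P ⊆ X ∧ P.card = 2) ∧ Q ⊆ Y ∧ Q.card = 2) ∧ ∀ a ∈ P, ∀ b ∈ Q, G.Adj a b := by
  simp [rectangles, Finset.mem_powersetCard]

/-- The complete bipartite subgraph between two completely joined sets of vertices. -/
def joinSubgraph (P Q : Finset V) (h : ∀ a ∈ P, ∀ b ∈ Q, G.Adj a b) : G.Subgraph where
  verts := {x | x ∈ P ∨ x ∈ Q}
  Adj x y := x ∈ P ∧ y ∈ Q ∨ x ∈ Q ∧ y ∈ P
  adj_sub := by
    rintro x y (⟨hx, hy⟩ | ⟨hx, hy⟩)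
    exacts [h x hx y hy, (h y hy x hx).symm]
  edge_vert := by
    rintro x y (⟨hx, -⟩ | ⟨hx, -⟩)
    exacts [Or.inl hx, Or.inr hx]
  symm := ⟨by rintro x y (⟨hx, hy⟩ | ⟨hx, hy⟩) <;> tauto⟩

lemma nonempty_cycleGraph_four_iso_joinSubgraph {P Q : Finset V} (hPc : P.card = 2)
    (hQc : Q.card = 2) (hPQ : Disjoint P Q) (h : ∀ a ∈ P, ∀ b ∈ Q, G.Adj a b) :
    Nonempty (cycleGraph 4 ≃g (joinSubgraph P Q h).coe) := by
  classical
  obtain ⟨a, c, hac, rfl⟩ := Finset.card_eq_two.mp hPc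
  obtain ⟨b, d, hbd, rfl⟩ := Finset.card_eq_two.mp hQc
  simp only [Finset.disjoint_insert_left, Finset.disjoint_singleton_left, Finset.mem_insert,
    Finset.mem_singleton, not_or] at hPQ
  obtain ⟨⟨hab, had⟩, hcb, hcd⟩ := hPQ
  let f : Fin 4 → V := ![a, b, c, d]
  have hf : ∀ i, f i ∈ (joinSubgraph {a, c} {b, d} h).verts := by
    intro i
    fin_cases i <;> simp [f, joinSubgraph]
  refine ⟨Equiv.ofBijective (fun i => ⟨f i, hf i⟩) ⟨?_, ?_⟩, ?_⟩
  · intro i j hij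
    have hij' : f i = f j := congrArg Subtype.val hij
    fin_cases i <;> fin_cases j <;> simp [f] at hij' ⊢ <;> grind
  · rintro ⟨x, hx⟩
    have hx' : x = a ∨ x = b ∨ x = c ∨ x = d := by
      simp only [joinSubgraph, Finset.mem_insert, Finset.mem_singleton, Set.mem_ofPred_eq] at hx
      tauto
    rcases hx' with rfl | rfl | rfl | rfl
    exacts [⟨0, rfl⟩, ⟨1, rfl⟩, ⟨2, rfl⟩, ⟨3, rfl⟩]
  · intro i j
    change (joinSubgraph {a, c} {b, d} h).Adj (f i) (f j) ↔ _
    fin_cases i <;> fin_cases j <;>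
      simp [f, joinSubgraph, cycleGraph_adj] <;> grind

/-- A 4-cycle in a bipartite graph is the join of a pair in one side and a pair in the other. -/
lemma IsBipartiteWith.exists_eq_joinSubgraph (hXY : G.IsBipartiteWith (X : Set V) Y)
    {H : G.Subgraph} (φ : cycleGraph 4 ≃g H.coe) :
    ∃ P Q, ∃ hr : (P, Q) ∈ G.rectangles X Y, joinSubgraph P Q (mem_rectangles.mp hr).2 = H := by
  classical
  let f : Fin 4 → V := fun i => φ i
  have hinj : Function.Injective f := Subtype.val_injective.comp φ.injective
  have hadj : ∀ i j, H.Adj (f i) (f j) ↔ (cycleGraph 4).Adj i j := fun i j => φ.map_rel_iff'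
  have hverts : ∀ x, x ∈ H.verts ↔ ∃ i, f i = x := by
    refine fun x => ⟨fun hx => ?_, ?_⟩
    · obtain ⟨i, hi⟩ := φ.surjective ⟨x, hx⟩
      exact ⟨i, congrArg Subtype.val hi⟩
    · rintro ⟨i, rfl⟩
      exact (φ i).2
  have h01 : H.Adj (f 0) (f 1) := (hadj 0 1).mpr (by decide)
  have h12 : H.Adj (f 1) (f 2) := (hadj 1 2).mpr (by decide)
  have h23 : H.Adj (f 2) (f 3) := (hadj 2 3).mpr (by decide)
  have h30 : H.Adj (f 3) (f 0) := (hadj 3 0).mpr (by decide)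
  have n02 : f 0 ≠ f 2 := hinj.ne (by decide)
  have n13 : f 1 ≠ f 3 := hinj.ne (by decide)
  have hH : ∀ x y, H.Adj x y ↔
      x ∈ ({f 0, f 2} : Finset V) ∧ y ∈ ({f 1, f 3} : Finset V) ∨
        x ∈ ({f 1, f 3} : Finset V) ∧ y ∈ ({f 0, f 2} : Finset V) := by
    intro x y
    simp only [Finset.mem_insert, Finset.mem_singleton]
    constructor
    · intro hxy
      obtain ⟨i, rfl⟩ := (hverts x).mp (H.edge_vert hxy)
      obtain ⟨j, rfl⟩ := (hverts y).mp (H.edge_vert hxy.symm)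
      have hij := (hadj i j).mp hxy
      have hpar : (i = 0 ∨ i = 2) ∧ (j = 1 ∨ j = 3) ∨ (i = 1 ∨ i = 3) ∧ (j = 0 ∨ j = 2) := by
        clear hxy
        revert i j
        simp only [cycleGraph_adj]
        decide
      rcases hpar with ⟨rfl | rfl, rfl | rfl⟩ | ⟨rfl | rfl, rfl | rfl⟩ <;> simp
    · have := h01.symm; have := h12.symm; have := h23.symm; have := h30.symm
      rintro (⟨rfl | rfl, rfl | rfl⟩ | ⟨rfl | rfl, rfl | rfl⟩) <;> assumption
  have hV : ∀ x, x ∈ H.verts ↔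
      x ∈ ({f 0, f 2} : Finset V) ∨ x ∈ ({f 1, f 3} : Finset V) := by
    intro x
    simp only [hverts, Fin.exists_fin_succ, Finset.mem_insert, Finset.mem_singleton]
    simp
    grind
  have hdisj := Finset.disjoint_left.mp (Finset.disjoint_coe.mp hXY.disjoint)
  have g01 := hXY.mem_of_adj h01.adj_sub
  have g12 := hXY.mem_of_adj h12.adj_sub
  have g23 := hXY.mem_of_adj h23.adj_sub
  have hG : ∀ a ∈ ({f 0, f 2} : Finset V), ∀ b ∈ ({f 1, f 3} : Finset V), G.Adj a b :=
    fun a ha b hb => ((hH a b).mpr (Or.inl ⟨ha, hb⟩)).adj_sub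
  simp only [Finset.mem_coe] at g01 g12 g23
  -- the even vertices of the cycle lie in one side; which one is decided by the vertex `f 0`
  rcases g01 with ⟨g0, g1⟩ | ⟨g0, g1⟩
  · refine ⟨{f 0, f 2}, {f 1, f 3}, mem_rectangles.mpr ⟨⟨⟨?_, Finset.card_pair n02⟩, ?_,
      Finset.card_pair n13⟩, hG⟩, ?_⟩
    · grind
    · grind
    · ext x y
      · exact (hV x).symm
      · exact (hH x y).symm
  · refine ⟨{f 1, f 3}, {f 0, f 2}, mem_rectangles.mpr ⟨⟨⟨?_, Finset.card_pair n13⟩, ?_,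
      Finset.card_pair n02⟩, fun a ha b hb => (hG b hb a ha).symm⟩, ?_⟩
    · grind
    · grind
    · ext x y
      · exact Or.comm.trans (hV x).symm
      · exact Or.comm.trans (hH x y).symm

lemma IsBipartiteWith.copyCount_cycleGraph_four_eq_card_rectangles [Fintype V]
    (hXY : G.IsBipartiteWith (X : Set V) Y) :
    G.copyCount (cycleGraph 4) = (G.rectangles X Y).card := by
  classical
  have hdisj : ∀ x, x ∈ X → x ∉ Y := fun x hx hy =>
    Set.disjoint_left.mp hXY.disjoint (Finset.mem_coe.mpr hx) (Finset.mem_coe.mpr hy)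
  rw [copyCount]
  symm
  refine Finset.card_bij (fun r hr => joinSubgraph r.1 r.2 (mem_rectangles.mp hr).2) ?_ ?_ ?_
  · rintro ⟨P, Q⟩ hr
    obtain ⟨⟨⟨hP, hPc⟩, hQ, hQc⟩, -⟩ := mem_rectangles.mp hr
    simp only [Finset.mem_filter, Finset.mem_univ, true_and]
    exact nonempty_cycleGraph_four_iso_joinSubgraph hPc hQc
      (Finset.disjoint_left.mpr fun x hx hx' => hdisj x (hP hx) (hQ hx')) _
  · rintro ⟨P, Q⟩ hr ⟨P', Q'⟩ hr' heq
    obtain ⟨⟨⟨hP, -⟩, hQ, -⟩, -⟩ := mem_rectangles.mp hr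
    obtain ⟨⟨⟨hP', -⟩, hQ', -⟩, -⟩ := mem_rectangles.mp hr'
    have hv : ∀ x, (x ∈ P ∨ x ∈ Q) ↔ (x ∈ P' ∨ x ∈ Q') := fun x =>
      iff_of_eq (congrArg (fun H : G.Subgraph => x ∈ H.verts) heq)
    ext x
    · have := hv x; have := @hP x; have := @hQ x; have := @hP' x; have := @hQ' x
      have := hdisj x; tauto
    · have := hv x; have := @hP x; have := @hQ x; have := @hP' x; have := @hQ' x
      have := hdisj x; tauto
  · intro H hH
    obtain ⟨φ⟩ := (Finset.mem_filter.mp hH).2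
    obtain ⟨P, Q, hr, h⟩ := hXY.exists_eq_joinSubgraph φ
    exact ⟨(P, Q), hr, h⟩

/-! ### Edges opposite to a given edge -/

open Classical in
/-- The pairs `(a, b)` of `X × Y` such that `u, v, a, b` are the consecutive vertices of a 4-cycle,
for an edge `uv` with `u ∈ X` and `v ∈ Y`: the edges `ab` opposite to `uv`. -/
noncomputable def oppositePairs (G : SimpleGraph V) (X Y : Finset V) (u v : V) : Finset (V × V) :=
  {p ∈ X ×ˢ Y | p.1 ≠ u ∧ p.2 ≠ v ∧ G.Adj p.1 v ∧ G.Adj u p.2 ∧ G.Adj p.1 p.2}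

lemma mem_oppositePairs {a b : V} :
    (a, b) ∈ G.oppositePairs X Y u v ↔
      (a ∈ X ∧ b ∈ Y) ∧ a ≠ u ∧ b ≠ v ∧ G.Adj a v ∧ G.Adj u b ∧ G.Adj a b := by
  simp [oppositePairs]

/-- The set of edges of `G` opposite to the edge `uv`. -/
def oppositeEdges (G : SimpleGraph V) (X Y : Finset V) (u v : V) : Set (Sym2 V) :=
  (fun p : V × V => s(p.1, p.2)) '' (G.oppositePairs X Y u v : Set (V × V))

lemma mk_mem_oppositeEdges {x y : V} :
    s(x, y) ∈ G.oppositeEdges X Y u v ↔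
      (x, y) ∈ G.oppositePairs X Y u v ∨ (y, x) ∈ G.oppositePairs X Y u v := by
  simp only [oppositeEdges, Set.mem_image, Finset.mem_coe, Prod.exists, Sym2.eq_iff]
  grind

lemma card_rectangles_le_card_rectangles_deleteEdges_add (hXY : Disjoint X Y) (hv : v ∈ Y) :
    (G.rectangles X Y).card ≤
      ((G.deleteEdges {s(u, v)}).rectangles X Y).card + (G.oppositePairs X Y u v).card := by
  classical
  have hsub : G.rectangles X Y ⊆ (G.deleteEdges {s(u, v)}).rectangles X Y ∪
      (G.oppositePairs X Y u v).image (fun p => ({u, p.1}, {v, p.2})) := by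
    rintro ⟨P, Q⟩ hr
    obtain ⟨⟨⟨hP, hPc⟩, hQ, hQc⟩, hadj⟩ := mem_rectangles.mp hr
    rw [Finset.mem_union, or_iff_not_imp_left]
    intro hn
    have huv : u ∈ P ∧ v ∈ Q := by
      by_contra hcon
      refine hn (mem_rectangles.mpr ⟨⟨⟨hP, hPc⟩, hQ, hQc⟩, fun a ha b hb => ?_⟩)
      rw [deleteEdges_adj]
      refine ⟨hadj a ha b hb, ?_⟩
      have h1 := Finset.disjoint_left.mp hXY (hP ha)
      simp only [Set.mem_singleton_iff, Sym2.eq_iff]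
      grind
    obtain ⟨a, hau⟩ : ∃ a, P.erase u = {a} :=
      Finset.card_eq_one.mp (by rw [Finset.card_erase_of_mem huv.1, hPc])
    obtain ⟨b, hbv⟩ : ∃ b, Q.erase v = {b} :=
      Finset.card_eq_one.mp (by rw [Finset.card_erase_of_mem huv.2, hQc])
    have ha : a ∈ P.erase u := by simp [hau]
    have hb : b ∈ Q.erase v := by simp [hbv]
    rw [Finset.mem_erase] at ha hb
    refine Finset.mem_image.mpr ⟨(a, b), mem_oppositePairs.mpr ⟨⟨hP ha.2, hQ hb.2⟩, ha.1, hb.1,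
      hadj a ha.2 v huv.2, hadj u huv.1 b hb.2, hadj a ha.2 b hb.2⟩, ?_⟩
    simp only
    rw [← hau, ← hbv, Finset.insert_erase huv.1, Finset.insert_erase huv.2]
  exact (Finset.card_le_card hsub).trans <| (Finset.card_union_le _ _).trans <|
    Nat.add_le_add_left Finset.card_image_le _

lemma card_edgeSet_deleteEdges_oppositeEdges_add [Finite V] (hXY : Disjoint X Y) :
    Nat.card (G.deleteEdges (G.oppositeEdges X Y u v)).edgeSet + (G.oppositePairs X Y u v).card =
      Nat.card G.edgeSet := by
  have hinj : Set.InjOn (fun p : V × V => s(p.1, p.2)) (G.oppositePairs X Y u v : Set (V × V)) := by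
    rintro ⟨a, b⟩ hp ⟨a', b'⟩ hp' heq
    have h1 := mem_oppositePairs.mp (Finset.mem_coe.mp hp)
    have h2 := mem_oppositePairs.mp (Finset.mem_coe.mp hp')
    have h3 := Finset.disjoint_left.mp hXY h1.1.1
    simp only [Sym2.eq_iff] at heq
    grind
  have hsub : G.oppositeEdges X Y u v ⊆ G.edgeSet := by
    rintro _ ⟨⟨a, b⟩, hp, rfl⟩
    exact (mem_oppositePairs.mp (Finset.mem_coe.mp hp)).2.2.2.2.2
  rw [edgeSet_deleteEdges, Nat.card_coe_set_eq, Nat.card_coe_set_eq,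
    ← Set.ncard_sdiff_add_ncard_of_subset hsub, oppositeEdges, hinj.ncard_image, Set.ncard_coe_finset]

lemma deleteEdges_oppositeEdges_adj_left (hXY : Disjoint X Y) (hu : u ∈ X) {z : V}
    (h : G.Adj u z) : (G.deleteEdges (G.oppositeEdges X Y u v)).Adj u z := by
  have := Finset.disjoint_left.mp hXY hu
  rw [deleteEdges_adj, mk_mem_oppositeEdges, mem_oppositePairs, mem_oppositePairs]
  grind

lemma deleteEdges_oppositeEdges_adj_right (hXY : Disjoint X Y) (hv : v ∈ Y) {z : V}
    (h : G.Adj z v) : (G.deleteEdges (G.oppositeEdges X Y u v)).Adj z v := by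
  have := Finset.disjoint_right.mp hXY hv
  rw [deleteEdges_adj, mk_mem_oppositeEdges, mem_oppositePairs, mem_oppositePairs]
  grind

/-- Deleting the edges opposite to `uv` keeps a graph connected, since the ends of a deleted edge
`ab` are still joined by the path `a, v, u, b`. -/
lemma Connected.deleteEdges_oppositeEdges (hG : G.Connected) (hXY : Disjoint X Y) (hu : u ∈ X)
    (hv : v ∈ Y) (huv : G.Adj u v) : (G.deleteEdges (G.oppositeEdges X Y u v)).Connected := by
  set H := G.deleteEdges (G.oppositeEdges X Y u v) with hH
  have hHuv : H.Adj u v := deleteEdges_oppositeEdges_adj_left hXY hu huv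
  have key : ∀ a b, (a, b) ∈ G.oppositePairs X Y u v → H.Reachable a b := by
    intro a b hab
    obtain ⟨-, -, -, hav, hub, -⟩ := mem_oppositePairs.mp hab
    exact ((deleteEdges_oppositeEdges_adj_right hXY hv hav).reachable.trans
      hHuv.symm.reachable).trans (deleteEdges_oppositeEdges_adj_left hXY hu hub).reachable
  have hstep : ∀ x y, G.Adj x y → H.Reachable x y := by
    intro x y hxy
    by_cases hmem : s(x, y) ∈ G.oppositeEdges X Y u v
    · rcases mk_mem_oppositeEdges.mp hmem with h | h
      exacts [key _ _ h, (key _ _ h).symm]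
    · exact Adj.reachable (by rw [hH, deleteEdges_adj]; exact ⟨hxy, hmem⟩)
  have := hG.nonempty
  refine ⟨fun x y => ?_⟩
  obtain ⟨w⟩ := hG x y
  induction w with
  | nil => rfl
  | cons h _ ih => exact (hstep _ _ h).trans ih

lemma Connected.card_oppositePairs_add_card_le [Finite V] (hG : G.Connected) (hXY : Disjoint X Y)
    (hu : u ∈ X) (hv : v ∈ Y) (huv : G.Adj u v) :
    (G.oppositePairs X Y u v).card + Nat.card V ≤ Nat.card G.edgeSet + 1 := by
  have h1 := (hG.deleteEdges_oppositeEdges hXY hu hv huv).card_vert_le_card_edgeSet_add_one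
  have h2 := card_edgeSet_deleteEdges_oppositeEdges_add (G := G) (u := u) (v := v) hXY
  omega

lemma IsTree.eq_of_adj_of_dist_eq {x y w : V} (hG : G.IsTree) (hx : G.Adj x w) (hy : G.Adj y w)
    (hdx : G.dist u w = G.dist u x + 1) (hdy : G.dist u w = G.dist u y + 1) : x = y := by
  obtain ⟨p, hp⟩ := hG.connected.exists_walk_length_eq_dist u x
  obtain ⟨q, hq⟩ := hG.connected.exists_walk_length_eq_dist u y
  have hp' : (p.concat hx).IsPath := Walk.isPath_of_length_eq_dist _ (by simp [hp, hdx])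
  have hq' : (q.concat hy).IsPath := Walk.isPath_of_length_eq_dist _ (by simp [hq, hdy])
  have heq : p.concat hx = q.concat hy :=
    congrArg Subtype.val ((hG.isAcyclic.subsingleton_path u w).elim ⟨_, hp'⟩ ⟨_, hq'⟩)
  simpa using congrArg Walk.penultimate heq

/-- If the number of edges opposite to `uv` is the largest possible, then deleting them leaves a
tree. A vertex adjacent to neither `u` nor `v` keeps all its edges, so it is not a leaf of this tree
when `G` has no leaves; at maximal distance from `u` that is impossible. -/
lemma Connected.adj_or_adj_of_card_oppositePairs_eq [Finite V] (hG : G.Connected)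
    (hXY : Disjoint X Y) (hu : u ∈ X) (hv : v ∈ Y) (huv : G.Adj u v)
    (hleaf : ∀ x y, G.Adj x y → ∃ z, z ≠ y ∧ G.Adj x z)
    (hcard : (G.oppositePairs X Y u v).card + Nat.card V = Nat.card G.edgeSet + 1) (w : V) :
    G.Adj u w ∨ G.Adj v w := by
  set H := G.deleteEdges (G.oppositeEdges X Y u v) with hH
  have hconn : H.Connected := hG.deleteEdges_oppositeEdges hXY hu hv huv
  have hE := card_edgeSet_deleteEdges_oppositeEdges_add (G := G) (u := u) (v := v) hXY
  have hT : H.IsTree := isTree_iff_connected_and_card.mpr ⟨hconn, by rw [hH]; omega⟩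
  have hHu : ∀ z, G.Adj u z → H.Adj u z := fun z => deleteEdges_oppositeEdges_adj_left hXY hu
  have hHv : ∀ z, G.Adj z v → H.Adj z v := fun z => deleteEdges_oppositeEdges_adj_right hXY hv
  have hnear : ∀ z, G.Adj u z ∨ G.Adj v z → H.dist u z ≤ 2 := by
    rintro z (hz | hz)
    · exact (dist_le (hHu z hz).toWalk).trans (by simp)
    · exact (dist_le (Walk.cons (hHu v huv) (hHv z hz.symm).symm.toWalk)).trans (by simp)
  by_contra hw
  obtain ⟨m, hm, hmax⟩ := Set.exists_max_image {w | ¬(G.Adj u w ∨ G.Adj v w)} (H.dist u)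
    (Set.toFinite _) ⟨w, hw⟩
  rw [Set.mem_ofPred_eq, not_or] at hm
  have hmu : u ≠ m := by rintro rfl; exact hm.2 huv.symm
  have hm2 : 1 < H.dist u m :=
    hconn.one_lt_dist_of_ne_of_not_adj hmu fun h => hm.1 (deleteEdges_le _ h)
  have hHm : ∀ x, G.Adj m x → H.Adj x m := by
    intro x hx
    rw [hH, deleteEdges_adj, mk_mem_oppositeEdges, mem_oppositePairs, mem_oppositePairs]
    have := hm.1
    have := fun h : G.Adj m v => hm.2 h.symm
    exact ⟨hx.symm, by tauto⟩
  -- A neighbour farther from `u` has distance at least 3, so it violates the claim as well.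
  have hcloser : ∀ x, G.Adj m x → H.dist u m = H.dist u x + 1 := by
    intro x hx
    rcases hT.dist_eq_dist_add_one_of_adj u (hHm x hx) with h | h
    · have hxo : ¬(G.Adj u x ∨ G.Adj v x) := fun hn => by have := hnear x hn; omega
      have := hmax x hxo
      omega
    · exact h
  have : Nontrivial V := ⟨u, m, hmu⟩
  obtain ⟨x, hx⟩ := hG.preconnected.exists_adj_of_nontrivial m
  obtain ⟨y, hyx, hy⟩ := hleaf m x hx
  exact hyx (hT.eq_of_adj_of_dist_eq (hHm y hy) (hHm x hx) (hcloser y hy) (hcloser x hx))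

/-! ### The bound -/

lemma IsBipartiteWith.card_rectangles_eq_zero_of_isAcyclic [Finite V]
    (hXY : G.IsBipartiteWith (X : Set V) Y) (hG : G.IsAcyclic) : (G.rectangles X Y).card = 0 := by
  have := Fintype.ofFinite V
  rw [← hXY.copyCount_cycleGraph_four_eq_card_rectangles, copyCount_eq_zero]
  exact isAcyclic_iff_free_cycleGraph.mp hG 4 (by norm_num)

lemma IsBipartiteWith.anti {H : SimpleGraph V} {s t : Set V} (hG : G.IsBipartiteWith s t)
    (hHG : H ≤ G) : H.IsBipartiteWith s t :=
  ⟨hG.disjoint, fun _ _ h => hG.mem_of_adj (hHG h)⟩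

lemma card_edgeSet_deleteEdges_singleton_add_one [Finite V] (huv : G.Adj u v) :
    Nat.card (G.deleteEdges {s(u, v)}).edgeSet + 1 = Nat.card G.edgeSet := by
  rw [edgeSet_deleteEdges, Nat.card_coe_set_eq, Nat.card_coe_set_eq]
  exact Set.ncard_sdiff_singleton_add_one huv

lemma IsBipartiteWith.exists_adj_not_isBridge (hXY : G.IsBipartiteWith (X : Set V) Y)
    (hac : ¬G.IsAcyclic) : ∃ u v, u ∈ X ∧ v ∈ Y ∧ G.Adj u v ∧ ¬G.IsBridge s(u, v) := by
  simp only [isAcyclic_iff_forall_adj_isBridge, not_forall] at hac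
  obtain ⟨x, y, hxy, hbr⟩ := hac
  rcases hXY.mem_of_adj hxy with h | h
  · exact ⟨x, y, h.1, h.2, hxy, hbr⟩
  · exact ⟨y, x, h.2, h.1, hxy.symm, by rwa [Sym2.eq_swap]⟩

theorem IsBipartiteWith.card_rectangles_le [Finite V] (hXY : G.IsBipartiteWith (X : Set V) Y)
    (hG : G.Connected) :
    (G.rectangles X Y).card ≤ (Nat.card G.edgeSet + 2 - Nat.card V).choose 2 := by
  have hdisj : Disjoint X Y := Finset.disjoint_coe.mp hXY.disjoint
  induction hn : Nat.card G.edgeSet generalizing G with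
  | zero =>
    rw [hXY.card_rectangles_eq_zero_of_isAcyclic]
    · exact Nat.zero_le _
    · rw [isAcyclic_iff_forall_adj_isBridge]
      intro x y hxy
      have := card_edgeSet_deleteEdges_singleton_add_one hxy
      omega
  | succ n ih =>
    by_cases hac : G.IsAcyclic
    · rw [hXY.card_rectangles_eq_zero_of_isAcyclic hac]
      exact Nat.zero_le _
    obtain ⟨u, v, hu, hv, huv, hbr⟩ := hXY.exists_adj_not_isBridge hac
    have hE := card_edgeSet_deleteEdges_singleton_add_one huv
    have hconn := hG.connected_delete_edge_of_not_isBridge hbr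
    have h1 := ih (hXY.anti (deleteEdges_le _)) hconn (by omega)
    have h2 := hG.card_oppositePairs_add_card_le hdisj hu hv huv
    have h3 := card_rectangles_le_card_rectangles_deleteEdges_add (G := G) (u := u) hdisj hv
    have h4 := hconn.card_vert_le_card_edgeSet_add_one
    obtain ⟨k, hk⟩ : ∃ k, n + 2 - Nat.card V = k := ⟨_, rfl⟩
    have hch : (k + 1).choose 2 = k + k.choose 2 := by
      rw [Nat.choose_succ_succ, Nat.choose_one_right]
    rw [hk] at h1
    rw [show n + 1 + 2 - Nat.card V = k + 1 by omega, hch]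
    omega

/-! ### Equality -/

/-- If the bound is attained, every non-bridge has the largest possible number of opposite edges. -/
lemma IsBipartiteWith.card_oppositePairs_add_card_eq [Finite V]
    (hXY : G.IsBipartiteWith (X : Set V) Y) (hG : G.Connected)
    (heq : (G.rectangles X Y).card = (Nat.card G.edgeSet + 2 - Nat.card V).choose 2)
    (hu : u ∈ X) (hv : v ∈ Y) (huv : G.Adj u v) (hbr : ¬G.IsBridge s(u, v)) :
    (G.oppositePairs X Y u v).card + Nat.card V = Nat.card G.edgeSet + 1 := by
  have hdisj : Disjoint X Y := Finset.disjoint_coe.mp hXY.disjoint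
  have hE := card_edgeSet_deleteEdges_singleton_add_one huv
  have hconn := hG.connected_delete_edge_of_not_isBridge hbr
  have h1 := (hXY.anti (deleteEdges_le _)).card_rectangles_le hconn
  have h2 := hG.card_oppositePairs_add_card_le hdisj hu hv huv
  have h3 := card_rectangles_le_card_rectangles_deleteEdges_add (G := G) (u := u) hdisj hv
  have h4 := hconn.card_vert_le_card_edgeSet_add_one
  obtain ⟨k, hk⟩ : ∃ k, Nat.card G.edgeSet + 1 - Nat.card V = k := ⟨_, rfl⟩
  have hch : (k + 1).choose 2 = k + k.choose 2 := by
    rw [Nat.choose_succ_succ, Nat.choose_one_right]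
  rw [show Nat.card (G.deleteEdges {s(u, v)}).edgeSet + 2 - Nat.card V = k by omega] at h1
  rw [show Nat.card G.edgeSet + 2 - Nat.card V = k + 1 by omega, hch] at heq
  omega

/-- A connected bipartite graph without leaves that attains the bound is complete bipartite. -/
lemma IsBipartiteWith.adj_of_card_rectangles_eq [Finite V] [Nontrivial V]
    (hXY : G.IsBipartiteWith (X : Set V) Y) (hG : G.Connected)
    (hleaf : ∀ x y, G.Adj x y → ∃ z, z ≠ y ∧ G.Adj x z)
    (heq : (G.rectangles X Y).card = (Nat.card G.edgeSet + 2 - Nat.card V).choose 2) :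
    ∀ a ∈ X, ∀ b ∈ Y, G.Adj a b := by
  have hdisj : Disjoint X Y := Finset.disjoint_coe.mp hXY.disjoint
  have hnadjX : ∀ a ∈ X, ∀ b ∈ X, ¬G.Adj a b := by
    intro a ha b hb h
    have := hXY.mem_of_adj h
    have := Finset.disjoint_left.mp hdisj ha
    have := Finset.disjoint_left.mp hdisj hb
    simp_all
  have hnadjY : ∀ a ∈ Y, ∀ b ∈ Y, ¬G.Adj a b := by
    intro a ha b hb h
    have := hXY.mem_of_adj h
    have := Finset.disjoint_right.mp hdisj ha
    have := Finset.disjoint_right.mp hdisj hb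
    simp_all
  have hspan : ∀ u ∈ X, ∀ v ∈ Y, G.Adj u v → ¬G.IsBridge s(u, v) →
      (∀ b ∈ Y, G.Adj u b) ∧ ∀ a ∈ X, G.Adj a v := by
    intro u hu v hv huv hbr
    have h := hG.adj_or_adj_of_card_oppositePairs_eq hdisj hu hv huv hleaf
      (hXY.card_oppositePairs_add_card_eq hG heq hu hv huv hbr)
    exact ⟨fun b hb => (h b).resolve_right (hnadjY v hv b hb),
      fun a ha => ((h a).resolve_left (hnadjX u hu a ha)).symm⟩
  have hac : ¬G.IsAcyclic := by
    intro hac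
    classical
    have := Fintype.ofFinite V
    obtain ⟨x, hx⟩ := (IsTree.mk hG hac).exists_vert_degree_one_of_nontrivial
    obtain ⟨y, hy, hy'⟩ := degree_eq_one_iff_existsUnique_adj.mp hx
    obtain ⟨z, hzy, hz⟩ := hleaf x y hy
    exact hzy (hy' z hz)
  obtain ⟨u, v, hu, hv, huv, hbr⟩ := hXY.exists_adj_not_isBridge hac
  obtain ⟨hu', hv'⟩ := hspan u hu v hv huv hbr
  intro a ha
  by_cases hau : a = u
  · exact hau ▸ hu'
  -- The edge `av` lies on the 4-cycle `a, b, u, v`, so it is not a bridge either.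
  obtain ⟨b, hbv, hab⟩ := hleaf a v (hv' a ha)
  have hb : b ∈ Y := hXY.mem_of_mem_adj ha hab
  refine (hspan a ha v hv (hv' a ha) ?_).1
  rw [isBridge_iff, not_not]
  have hbX := Finset.disjoint_right.mp hdisj hb
  have hvX := Finset.disjoint_right.mp hdisj hv
  have h1 : (G.deleteEdges {s(a, v)}).Adj a b := by
    rw [deleteEdges_adj]
    refine ⟨hab, ?_⟩
    simp only [Set.mem_singleton_iff, Sym2.eq_iff]
    grind
  have h2 : (G.deleteEdges {s(a, v)}).Adj b u := by
    rw [deleteEdges_adj]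
    refine ⟨(hu' b hb).symm, ?_⟩
    simp only [Set.mem_singleton_iff, Sym2.eq_iff]
    grind
  have h3 : (G.deleteEdges {s(a, v)}).Adj u v := by
    rw [deleteEdges_adj]
    refine ⟨huv, ?_⟩
    simp only [Set.mem_singleton_iff, Sym2.eq_iff]
    grind
  exact (h1.reachable.trans h2.reachable).trans h3.reachable

lemma card_rectangles_of_forall_adj (h : ∀ a ∈ X, ∀ b ∈ Y, G.Adj a b) :
    (G.rectangles X Y).card = X.card.choose 2 * Y.card.choose 2 := by
  classical
  rw [rectangles, Finset.filter_true_of_mem, Finset.card_product, Finset.card_powersetCard,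
    Finset.card_powersetCard]
  rintro ⟨P, Q⟩ hr a ha b hb
  simp only [Finset.mem_product, Finset.mem_powersetCard] at hr
  exact h a (hr.1.1 ha) b (hr.2.1 hb)

lemma Iso.card_edgeSet_completeBipartiteGraph {W₁ W₂ : Type*} [Finite W₁] [Finite W₂]
    (φ : G ≃g completeBipartiteGraph W₁ W₂) :
    Nat.card G.edgeSet = Nat.card W₁ * Nat.card W₂ := by
  rw [Nat.card_congr φ.mapEdgeSet, Nat.card_coe_set_eq, Set.ncard,
    encard_edgeSet_completeBipartiteGraph, ENat.toNat_mul]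
  rfl

/-- A graph bipartite with sides `X`, `Y` that cover all vertices and are completely joined is
isomorphic to the complete bipartite graph on these sides. -/
lemma IsBipartiteWith.nonempty_iso_completeBipartiteGraph
    (hXY : G.IsBipartiteWith (X : Set V) Y) (hcover : ∀ x, x ∈ X ∨ x ∈ Y)
    (h : ∀ a ∈ X, ∀ b ∈ Y, G.Adj a b) : Nonempty (G ≃g completeBipartiteGraph X Y) := by
  have hdisj : Disjoint X Y := Finset.disjoint_coe.mp hXY.disjoint
  let f : X ⊕ Y → V := Sum.elim Subtype.val Subtype.val
  have hf : Function.Bijective f := by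
    constructor
    · rintro (⟨a, ha⟩ | ⟨a, ha⟩) (⟨b, hb⟩ | ⟨b, hb⟩) hab <;>
        simp only [f, Sum.elim_inl, Sum.elim_inr] at hab <;> subst hab
      · rfl
      · exact absurd hb (Finset.disjoint_left.mp hdisj ha)
      · exact absurd ha (Finset.disjoint_left.mp hdisj hb)
      · rfl
    · intro x
      rcases hcover x with hx | hx
      exacts [⟨.inl ⟨x, hx⟩, rfl⟩, ⟨.inr ⟨x, hx⟩, rfl⟩]
  refine ⟨RelIso.symm ⟨Equiv.ofBijective f hf, ?_⟩⟩
  have hX : ∀ a ∈ X, a ∉ Y := fun a ha => Finset.disjoint_left.mp hdisj ha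
  rintro (⟨a, ha⟩ | ⟨a, ha⟩) (⟨b, hb⟩ | ⟨b, hb⟩)
  · have hab : ¬G.Adj a b := fun hab => by
      have := hXY.mem_of_adj hab
      simp_all
    simpa [f] using hab
  · simpa [f] using h a ha b hb
  · simpa [f] using (h b hb a ha).symm
  · have hab : ¬G.Adj a b := fun hab => by
      rcases hXY.mem_of_adj hab with h | h
      exacts [hX a h.1 ha, hX b h.2 hb]
    simpa [f] using hab

lemma copyCount_cycleGraph_four_of_iso [Fintype V] {n : ℕ}
    (φ : G ≃g completeBipartiteGraph (Fin 2) (Fin n)) :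
    G.copyCount (cycleGraph 4) = n.choose 2 := by
  classical
  let X : Finset V := Finset.univ.image fun i => φ.symm (Sum.inl i)
  let Y : Finset V := Finset.univ.image fun i => φ.symm (Sum.inr i)
  have hX : X.card = 2 := by
    refine (Finset.card_image_of_injective _ (φ.symm.injective.comp Sum.inl_injective)).trans ?_
    simp
  have hY : Y.card = n := by
    refine (Finset.card_image_of_injective _ (φ.symm.injective.comp Sum.inr_injective)).trans ?_
    simp
  have hXY : G.IsBipartiteWith (X : Set V) Y := by
    constructor
    · rw [Finset.disjoint_coe, Finset.disjoint_left]
      simp only [X, Y, Finset.mem_image, Finset.mem_univ, true_and]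
      rintro _ ⟨i, rfl⟩ ⟨j, hj⟩
      exact Sum.inr_ne_inl (φ.symm.injective hj)
    · intro v w hvw
      have hvw' := φ.map_adj_iff.mpr hvw
      obtain ⟨x, rfl⟩ := φ.symm.surjective v
      obtain ⟨y, rfl⟩ := φ.symm.surjective w
      simp only [RelIso.apply_symm_apply] at hvw'
      rcases x with x | x <;> rcases y with y | y <;> simp [X, Y] at hvw' ⊢
  rw [hXY.copyCount_cycleGraph_four_eq_card_rectangles, card_rectangles_of_forall_adj, hX, hY]
  · simp
  · simp only [X, Y, Finset.mem_image, Finset.mem_univ, true_and]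
    rintro _ ⟨i, rfl⟩ _ ⟨j, rfl⟩
    rw [Iso.map_adj_iff]
    simp

end SimpleGraph

lemma eq_zero_or_eq_zero_of_choose_two_mul_choose_two {p q : ℕ}
    (h : (p + 2).choose 2 * (q + 2).choose 2 = ((p + 1) * (q + 1) + 1).choose 2) :
    p = 0 ∨ q = 0 := by
  have h1 : ∀ n : ℕ, 2 * (n + 1).choose 2 = (n + 1) * n := fun n => by
    have := Nat.add_one_mul_choose_eq n 1
    simp only [Nat.choose_one_right, Nat.reduceAdd] at this
    omega
  have h2 := h1 (p + 1)
  have h3 := h1 (q + 1)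
  have h4 := h1 ((p + 1) * (q + 1))
  have h5 : (p + 1) * (q + 1) * (p * q) = 0 := by
    nlinarith
  simpa using h5

/-- For a finite connected bipartite simple graph `G` with `d` vertices and `e` edges, the number
`c₄(G)` of subgraphs of `G` isomorphic to the 4-cycle is at most `(e - d + 2).choose 2`; if moreover
`d ≥ 2` and no vertex has degree one, equality holds iff `G` is isomorphic to `K_{2, d - 2}`.
Since `G` is connected, `d ≤ e + 1`, so the subtraction in `e + 2 - d` does not truncate. -/
theorem proposition1p4 {V : Type*} [Fintype V] [DecidableEq V] (G : SimpleGraph V)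
    [DecidableRel G.Adj] (hconn : G.Connected) (hbip : G.IsBipartite) :
    G.copyCount (SimpleGraph.cycleGraph 4)
        ≤ (G.edgeFinset.card + 2 - Fintype.card V).choose 2 ∧
      (2 ≤ Fintype.card V → (∀ v : V, G.degree v ≠ 1) →
        (G.copyCount (SimpleGraph.cycleGraph 4)
            = (G.edgeFinset.card + 2 - Fintype.card V).choose 2 ↔
          Nonempty (G ≃g completeBipartiteGraph (Fin 2) (Fin (Fintype.card V - 2))))) := by
  classical
  obtain ⟨s, t, hst⟩ := SimpleGraph.isBipartite_iff_exists_isBipartiteWith.mp hbip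
  obtain ⟨X, rfl⟩ : ∃ X : Finset V, (X : Set V) = s := ⟨s.toFinset, by simp⟩
  obtain ⟨Y, rfl⟩ : ∃ Y : Finset V, (Y : Set V) = t := ⟨t.toFinset, by simp⟩
  rw [show G.edgeFinset.card = Nat.card G.edgeSet by
    rw [Nat.card_eq_fintype_card, SimpleGraph.edgeFinset_card], ← Nat.card_eq_fintype_card]
  refine ⟨hst.copyCount_cycleGraph_four_eq_card_rectangles ▸ hst.card_rectangles_le hconn,
    fun hd hdeg => ⟨fun heq => ?_, ?_⟩⟩
  · have : Nontrivial V := by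
      rwa [← Fintype.one_lt_card_iff_nontrivial, ← Nat.card_eq_fintype_card]
    have hleaf : ∀ x y, G.Adj x y → ∃ z, z ≠ y ∧ G.Adj x z := by
      intro x y hxy
      by_contra! hcon
      exact hdeg x (SimpleGraph.degree_eq_one_iff_existsUnique_adj.mpr
        ⟨y, hxy, fun z hz => by_contra fun hzy => hcon z hzy hz⟩)
    rw [hst.copyCount_cycleGraph_four_eq_card_rectangles] at heq
    have hadj := hst.adj_of_card_rectangles_eq hconn hleaf heq
    have hcover : ∀ x, x ∈ X ∨ x ∈ Y := by
      intro x
      obtain ⟨y, hxy⟩ := hconn.preconnected.exists_adj_of_nontrivial x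
      rcases hst.mem_of_adj hxy with h | h
      exacts [Or.inl h.1, Or.inr h.1]
    obtain ⟨φ⟩ := hst.nonempty_iso_completeBipartiteGraph hcover hadj
    have hE := φ.card_edgeSet_completeBipartiteGraph
    have hV : Nat.card V = X.card + Y.card := by
      rw [Nat.card_congr φ.toEquiv]
      simp
    rw [Nat.card_eq_fintype_card (α := X), Nat.card_eq_fintype_card (α := Y), Fintype.card_coe,
      Fintype.card_coe] at hE
    rw [SimpleGraph.card_rectangles_of_forall_adj hadj, hE, hV] at heq
    -- Each side has at least two vertices: a vertex and its two neighbours show this.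
    have hside : 2 ≤ X.card ∧ 2 ≤ Y.card := by
      have htwo : ∀ x, ∃ y z, y ≠ z ∧ G.Adj x y ∧ G.Adj x z := by
        intro x
        obtain ⟨y, hxy⟩ := hconn.preconnected.exists_adj_of_nontrivial x
        obtain ⟨z, hzy, hxz⟩ := hleaf x y hxy
        exact ⟨y, z, hzy.symm, hxy, hxz⟩
      have hY : ∀ x ∈ X, 2 ≤ Y.card := by
        intro x hx
        obtain ⟨y, z, hyz, hxy, hxz⟩ := htwo x
        exact Finset.one_lt_card.mpr
          ⟨y, hst.mem_of_mem_adj hx hxy, z, hst.mem_of_mem_adj hx hxz, hyz⟩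
      have hX : ∀ x ∈ Y, 2 ≤ X.card := by
        intro x hx
        obtain ⟨y, z, hyz, hxy, hxz⟩ := htwo x
        exact Finset.one_lt_card.mpr
          ⟨y, hst.symm.mem_of_mem_adj hx hxy, z, hst.symm.mem_of_mem_adj hx hxz, hyz⟩
      obtain ⟨x⟩ := hconn.nonempty
      obtain ⟨y, hxy⟩ := hconn.preconnected.exists_adj_of_nontrivial x
      rcases hst.mem_of_adj hxy with h | h
      exacts [⟨hX y h.2, hY x h.1⟩, ⟨hX x h.1, hY y h.2⟩]
    obtain ⟨p, hp⟩ := Nat.exists_eq_add_of_le' hside.1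
    obtain ⟨q, hq⟩ := Nat.exists_eq_add_of_le' hside.2
    rw [hp, hq, show (p + 2) * (q + 2) + 2 - (p + 2 + (q + 2)) = (p + 1) * (q + 1) + 1 by
      have : (p + 2) * (q + 2) = p * q + 2 * p + 2 * q + 4 := by ring
      have : (p + 1) * (q + 1) = p * q + p + q + 1 := by ring
      omega] at heq
    rcases eq_zero_or_eq_zero_of_choose_two_mul_choose_two heq with rfl | rfl
    · exact ⟨φ.trans (SimpleGraph.completeBipartiteGraphCongr (Finset.equivFinOfCardEq hp)
        (Finset.equivFinOfCardEq (by omega)))⟩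
    · obtain ⟨ψ⟩ := hst.symm.nonempty_iso_completeBipartiteGraph (fun x => (hcover x).symm)
        fun b hb a ha => (hadj a ha b hb).symm
      exact ⟨ψ.trans (SimpleGraph.completeBipartiteGraphCongr (Finset.equivFinOfCardEq hq)
        (Finset.equivFinOfCardEq (by omega)))⟩
  · rintro ⟨φ⟩
    rw [SimpleGraph.copyCount_cycleGraph_four_of_iso φ, φ.card_edgeSet_completeBipartiteGraph]
    simp only [Nat.card_eq_fintype_card, Fintype.card_fin] at hd ⊢
    congr 1
    omega
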